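/- Let $d\ge 2$ and let $\mathcal T_d$ be the rooted $d$-regular tree, in which every vertex has exactly $d$ children. A subtree $S\subset\mathcal T_d$ is called admissible if it is finite, contains the root, and contains all the children of each of its vertices that is not a leaf of $S$ (i.e. that has at least one child in $S$). For $S$ admissible, let $\mathcal T_d\setminus\!\!\setminus S$ be the cofinite subforest of $\mathcal T_d$ obtained by removing all the edges of $S$ and all the non-leaf vertices of $S$. The Neretin group $\mathcal N_d$ is the group, under composition, of equivalence classes of triples $(\psi,S,S')$, where $S,S'$ are admissible subtrees and $\psi:\mathcal T_d\setminus\!\!\setminus S\to\mathcal T_d\setminus\!\!\setminus S'$ is a forest isomorphism; two triples $(\psi_1,S_1,S_1')$ and $(\psi_2,S_2,S_2')$ are equivalent if there are admissible subtrees $S\supset S_1\cup S_2$ and $S'\supset S_1'\cup S_2'$ such that $\psi_1$ and $\psi_2$ induce the same forest isomorphism $\mathcal T_d\setminus\!\!\setminus S\to\mathcal T_d\setminus\!\!\setminus S'$. For $S$ admissible, let $\mathrm{Aut}(\mathcal T_d\setminus\!\!\setminus S)\le\mathcal N_d$ denote the subgroup of the classes that have a representative of the form $(\psi,S,S)$.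 Theorem. Let $H\le\mathcal N_d$ be a finitely generated subgroup. If for every $h\in H$ there is an admissible subtree $S_h$ with $h\in\mathrm{Aut}(\mathcal T_d\setminus\!\!\setminus S_h)$, then there is a single admissible subtree $S$ with $H\le\mathrm{Aut}(\mathcal T_d\setminus\!\!\setminus S)$. -/

import Mathlib

namespace Neretin

/-- Vertices of the rooted `d`-regular tree, in which every vertex has exactly `d` children: words
over `Fin d`. The root is `[]`, and the children of `v` are the words `i :: v`. -/
abbrev Vertex (d : ℕ) : Type := List (Fin d)

/-- The rooted `d`-regular tree, as a graph. -/
def tree (d : ℕ) : SimpleGraph (Vertex d) where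
  Adj v w := (∃ i, w = i :: v) ∨ (∃ i, v = i :: w)
  symm := ⟨fun _ _ h => h.symm⟩
  loopless := ⟨fun v h => by rcases h with ⟨i, h⟩ | ⟨i, h⟩ <;> simp at h⟩

/-- Admissible subtrees: finite subtrees containing the root, such that a vertex of the subtree
with at least one child in the subtree has all its children in the subtree. -/
@[ext]
structure AdmissibleSubtree (d : ℕ) where
  /-- the vertices of the subtree -/
  verts : Finset (Vertex d)
  root_mem : [] ∈ verts
  parent_mem : ∀ (i : Fin d) (v : Vertex d), i :: v ∈ verts → v ∈ verts
  children_mem : ∀ (i j : Fin d) (v : Vertex d), i :: v ∈ verts → j :: v ∈ verts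

namespace AdmissibleSubtree

variable {d : ℕ}

/-- Inclusion of admissible subtrees. -/
instance : LE (AdmissibleSubtree d) := ⟨fun S T => S.verts ⊆ T.verts⟩

/-- The interior vertices of `S`, i.e. the vertices of `S` that are not leaves of `S`. -/
def interior (S : AdmissibleSubtree d) : Set (Vertex d) := {v | ∃ i : Fin d, i :: v ∈ S.verts}

/-- The forest obtained from the tree by removing the interior vertices and the edges of `S`. An
edge of `S` always has an interior vertex of `S` as its upper endpoint, so this is the subgraph
induced on the vertices that are not interior to `S`. -/
def forest (S : AdmissibleSubtree d) : SimpleGraph ↥(S.interior)ᶜ :=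
  (tree d).induce (S.interior)ᶜ

theorem interior_parent (S : AdmissibleSubtree d) {i : Fin d} {v : Vertex d}
    (h : i :: v ∈ S.interior) : v ∈ S.interior := by
  obtain ⟨j, hj⟩ := h
  exact ⟨i, S.parent_mem _ _ hj⟩

theorem interior_finite (S : AdmissibleSubtree d) : S.interior.Finite :=
  S.verts.finite_toSet.subset fun _ ⟨i, hi⟩ => S.parent_mem i _ hi

theorem le_of_interior_subset {S T : AdmissibleSubtree d} (h : S.interior ⊆ T.interior) :
    S ≤ T := by
  intro v hv
  cases v with
  | nil => exact T.root_mem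
  | cons i v =>
    obtain ⟨j, hj⟩ := h (show v ∈ S.interior from ⟨i, hv⟩)
    exact T.children_mem j i v hj

theorem interior_mono {S T : AdmissibleSubtree d} (h : S ≤ T) : S.interior ⊆ T.interior :=
  fun _ ⟨i, hi⟩ => ⟨i, h hi⟩

/-- The union of two admissible subtrees. -/
def union (S T : AdmissibleSubtree d) : AdmissibleSubtree d where
  verts := S.verts ∪ T.verts
  root_mem := Finset.mem_union_left _ S.root_mem
  parent_mem i v h := by
    rcases Finset.mem_union.1 h with h | h
    · exact Finset.mem_union_left _ (S.parent_mem i v h)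
    · exact Finset.mem_union_right _ (T.parent_mem i v h)
  children_mem i j v h := by
    rcases Finset.mem_union.1 h with h | h
    · exact Finset.mem_union_left _ (S.children_mem i j v h)
    · exact Finset.mem_union_right _ (T.children_mem i j v h)

theorem interior_union (S T : AdmissibleSubtree d) :
    (S.union T).interior = S.interior ∪ T.interior := by
  ext v
  simp [interior, union, exists_or]

/-- The admissible subtree reduced to the root. -/
def root (d : ℕ) : AdmissibleSubtree d where
  verts := {[]}
  root_mem := by simp
  parent_mem := by simp
  children_mem := by simp

/-- The admissible subtree with a given finite parent-closed set of interior vertices. -/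
noncomputable def ofInterior (I : Set (Vertex d)) (hfin : I.Finite)
    (hI : ∀ (i : Fin d) (v : Vertex d), i :: v ∈ I → v ∈ I) : AdmissibleSubtree d where
  verts := insert [] ((hfin.toFinset ×ˢ Finset.univ).image fun p => p.2 :: p.1)
  root_mem := by simp
  parent_mem i v h := by
    cases v with
    | nil => simp
    | cons j v =>
      simp only [Finset.mem_insert, Finset.mem_image, Finset.mem_product, Prod.exists] at h ⊢
      right
      rcases h with h | ⟨w, k, ⟨hw, _⟩, hk⟩
      · simp at h
      · simp only [List.cons.injEq] at hk
        obtain ⟨rfl, rfl⟩ := hk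
        exact ⟨v, j, ⟨by simpa using hI _ _ (by simpa using hw), by simp⟩, rfl⟩
  children_mem i j v h := by
    simp only [Finset.mem_insert, Finset.mem_image, Finset.mem_product, Prod.exists] at h ⊢
    right
    rcases h with h | ⟨w, k, ⟨hw, _⟩, hk⟩
    · simp at h
    · simp only [List.cons.injEq] at hk
      obtain ⟨rfl, rfl⟩ := hk
      exact ⟨w, j, ⟨hw, by simp⟩, rfl⟩

theorem interior_ofInterior (I : Set (Vertex d)) (hfin : I.Finite)
    (hI : ∀ (i : Fin d) (v : Vertex d), i :: v ∈ I → v ∈ I) (hne : ∀ v ∈ I, Nonempty (Fin d)) :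
    (ofInterior I hfin hI).interior = I := by
  ext v
  simp only [interior, ofInterior, Finset.mem_insert, Finset.mem_image, Finset.mem_product,
    Prod.exists, Set.mem_ofPred_eq]
  constructor
  · rintro ⟨i, h | ⟨w, k, ⟨hw, _⟩, hk⟩⟩
    · simp at h
    · simp only [List.cons.injEq] at hk
      obtain ⟨rfl, rfl⟩ := hk
      simpa using hw
  · intro hv
    obtain ⟨i⟩ := hne v hv
    exact ⟨i, Or.inr ⟨v, i, ⟨by simpa using hv, by simp⟩, rfl⟩⟩

end AdmissibleSubtree

open AdmissibleSubtree

/-- Triples `(ψ, S, S')`, where `S` and `S'` are admissible subtrees and `ψ` is an isomorphism from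
the forest complementary to `S` onto the forest complementary to `S'`. -/
structure ForestIso (d : ℕ) where
  source : AdmissibleSubtree d
  target : AdmissibleSubtree d
  map : source.forest ≃g target.forest

namespace ForestIso

variable {d : ℕ}

/-- `c` is the forest isomorphism induced by `a` on a smaller forest. -/
def Induces (a c : ForestIso d) : Prop :=
  a.source ≤ c.source ∧ a.target ≤ c.target ∧
    ∀ (v : Vertex d) (ha : v ∈ (a.source.interior)ᶜ) (hc : v ∈ (c.source.interior)ᶜ),
      (a.map ⟨v, ha⟩ : Vertex d) = c.map ⟨v, hc⟩

/-- Two triples are equivalent if they induce the same isomorphism between the forests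
complementary to some larger admissible subtrees. -/
def Equivalent (a b : ForestIso d) : Prop := ∃ c : ForestIso d, a.Induces c ∧ b.Induces c

theorem map_adj_cases {S T : AdmissibleSubtree d} (φ : S.forest ≃g T.forest)
    (x y : ↥(S.interior)ᶜ) (h : S.forest.Adj x y) :
    (∃ j, (φ y : Vertex d) = j :: (φ x : Vertex d)) ∨
      (∃ j, (φ x : Vertex d) = j :: (φ y : Vertex d)) :=
  (φ.map_adj_iff.2 h : T.forest.Adj (φ x) (φ y))

/-- A forest isomorphism sends children of a root of the forest to children. -/
theorem map_child_of_root {S T : AdmissibleSubtree d} (φ : S.forest ≃g T.forest) (v : Vertex d)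
    (i : Fin d) (hv : v ∈ (S.interior)ᶜ) (hiv : i :: v ∈ (S.interior)ᶜ)
    (hr : ∀ (m : Fin d) (w : Vertex d), v = m :: w → w ∈ S.interior) :
    ∃ j, (φ ⟨i :: v, hiv⟩ : Vertex d) = j :: (φ ⟨v, hv⟩ : Vertex d) := by
  rcases map_adj_cases φ ⟨v, hv⟩ ⟨i :: v, hiv⟩ (Or.inl ⟨i, rfl⟩) with h | ⟨j, hj⟩
  · exact h
  exfalso
  have ht : ∀ k : Fin d, k :: (φ ⟨v, hv⟩ : Vertex d) ∈ (T.interior)ᶜ :=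
    fun k hk => (φ ⟨v, hv⟩).2 (T.interior_parent hk)
  have h1 : ∀ o : Option (Fin d), ∃ k : Fin d, ∃ hk : k :: v ∈ (S.interior)ᶜ,
      o.elim (φ ⟨i :: v, hiv⟩ : Vertex d) (fun k => k :: (φ ⟨v, hv⟩ : Vertex d))
        = φ ⟨k :: v, hk⟩ := by
    intro o
    cases o with
    | none => exact ⟨i, hiv, rfl⟩
    | some k =>
      have hadj : S.forest.Adj ⟨v, hv⟩ (φ.symm ⟨_, ht k⟩) := by
        rw [← φ.map_adj_iff, RelIso.apply_symm_apply]
        exact Or.inl ⟨k, rfl⟩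
      rcases hadj with ⟨m, hm⟩ | ⟨m, hm⟩
      · change (φ.symm ⟨_, ht k⟩ : Vertex d) = m :: v at hm
        refine ⟨m, hm ▸ (φ.symm ⟨_, ht k⟩).2, ?_⟩
        have : (⟨m :: v, hm ▸ (φ.symm ⟨_, ht k⟩).2⟩ : ↥(S.interior)ᶜ) = φ.symm ⟨_, ht k⟩ :=
          Subtype.ext hm.symm
        rw [this, RelIso.apply_symm_apply]
        rfl
      · exact absurd (hr m _ hm) (φ.symm ⟨_, ht k⟩).2
  choose f hf hfe using h1
  have hne : ∀ k : Fin d, (φ ⟨i :: v, hiv⟩ : Vertex d) ≠ k :: (φ ⟨v, hv⟩ : Vertex d) := by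
    intro k h2
    have h3 := congrArg List.length hj
    rw [h2] at h3
    simp only [List.length_cons] at h3
    omega
  have hinj : Function.Injective f := by
    intro o p hop
    have h2 := (hfe o).trans ((by simp only [hop]) : _ = _) |>.trans (hfe p).symm
    cases o <;> cases p <;> simp only [Option.elim] at h2
    · rfl
    · exact absurd h2 (hne _)
    · exact absurd h2.symm (hne _)
    · simpa using h2
  have := Fintype.card_le_of_injective f hinj
  simp at this

/-- A forest isomorphism sends children to children. -/
theorem map_child {S T : AdmissibleSubtree d} (φ : S.forest ≃g T.forest) (v : Vertex d) (i : Fin d)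
    (hv : v ∈ (S.interior)ᶜ) (hiv : i :: v ∈ (S.interior)ᶜ) :
    ∃ j, (φ ⟨i :: v, hiv⟩ : Vertex d) = j :: (φ ⟨v, hv⟩ : Vertex d) := by
  induction v generalizing i with
  | nil => exact map_child_of_root φ [] i hv hiv (by simp)
  | cons p v ih =>
    by_cases hvS : v ∈ S.interior
    · refine map_child_of_root φ (p :: v) i hv hiv fun m w h => ?_
      obtain ⟨-, rfl⟩ := List.cons.inj h
      exact hvS
    · rcases map_adj_cases φ ⟨p :: v, hv⟩ ⟨i :: p :: v, hiv⟩ (Or.inl ⟨i, rfl⟩) with h | ⟨j, hj⟩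
      · exact h
      exfalso
      obtain ⟨k, hk⟩ := ih p hvS hv
      rw [hk] at hj
      have h1 := φ.injective (Subtype.ext (List.cons.inj hj).2)
      have h2 := congrArg (fun x : ↥(S.interior)ᶜ => (x : Vertex d).length) h1
      simp only [List.length_cons] at h2
      omega

/-- The interior vertices of the preimage of `U` under a forest isomorphism. -/
def pullSet (a : ForestIso d) (U : AdmissibleSubtree d) : Set (Vertex d) :=
  {v | ∀ h : v ∈ (a.source.interior)ᶜ, (a.map ⟨v, h⟩ : Vertex d) ∈ U.interior}

theorem pullSet_finite (a : ForestIso d) (U : AdmissibleSubtree d) : (a.pullSet U).Finite := by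
  have h : a.pullSet U ⊆ a.source.interior ∪
      (fun x => (a.map.symm x : Vertex d)) '' {x | (x : Vertex d) ∈ U.interior} := by
    intro v hv
    by_cases h : v ∈ a.source.interior
    · exact Or.inl h
    · refine Or.inr ⟨a.map ⟨v, h⟩, hv h, ?_⟩
      simp
  refine (a.source.interior_finite.union (Set.Finite.image _ ?_)).subset h
  exact U.interior_finite.preimage Subtype.val_injective.injOn

theorem pullSet_parent (a : ForestIso d) (U : AdmissibleSubtree d) (i : Fin d) (v : Vertex d)
    (h : i :: v ∈ a.pullSet U) : v ∈ a.pullSet U := by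
  intro hv
  have hiv : i :: v ∈ (a.source.interior)ᶜ := fun h' => hv (a.source.interior_parent h')
  obtain ⟨j, hj⟩ := map_child a.map v i hv hiv
  have := h hiv
  rw [hj] at this
  exact U.interior_parent this

theorem pullSet_nonempty (a : ForestIso d) (U : AdmissibleSubtree d) (v : Vertex d)
    (h : v ∈ a.pullSet U) : Nonempty (Fin d) := by
  by_cases hv : v ∈ a.source.interior
  · exact ⟨hv.choose⟩
  · exact ⟨(h hv).choose⟩

/-- The smallest admissible subtree containing the source of `a` and such that `a` sends its
complementary forest into the forest complementary to `U`. -/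
noncomputable def pull (a : ForestIso d) (U : AdmissibleSubtree d) : AdmissibleSubtree d :=
  ofInterior (a.pullSet U) (a.pullSet_finite U) (a.pullSet_parent U)

theorem interior_pull (a : ForestIso d) (U : AdmissibleSubtree d) :
    (a.pull U).interior = a.pullSet U :=
  interior_ofInterior _ _ _ (a.pullSet_nonempty U)

theorem mem_pull_compl (a : ForestIso d) (U : AdmissibleSubtree d) (v : Vertex d) :
    v ∈ ((a.pull U).interior)ᶜ ↔
      ∃ h : v ∈ (a.source.interior)ᶜ, (a.map ⟨v, h⟩ : Vertex d) ∈ (U.interior)ᶜ := by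
  rw [interior_pull]
  simp [pullSet]

/-- The identity of the forest complementary to `S`. -/
def refl (S : AdmissibleSubtree d) : ForestIso d := ⟨S, S, RelIso.refl _⟩

/-- The inverse of a forest isomorphism. -/
def symm (a : ForestIso d) : ForestIso d := ⟨a.target, a.source, a.map.symm⟩

/-- The composition `b ∘ a`, defined on the largest forest on which it makes sense. -/
noncomputable def comp (b a : ForestIso d) : ForestIso d where
  source := a.pull b.source
  target := b.symm.pull a.target
  map :=
    { toFun := fun x =>
        ⟨b.map ⟨a.map ⟨x, ((a.mem_pull_compl _ _).1 x.2).1⟩, ((a.mem_pull_compl _ _).1 x.2).2⟩,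
          (b.symm.mem_pull_compl _ _).2 ⟨(b.map _).2, by
            change (b.map.symm (b.map _) : Vertex d) ∈ _
            rw [RelIso.symm_apply_apply]
            exact (a.map _).2⟩⟩
      invFun := fun y =>
        ⟨a.map.symm ⟨b.map.symm ⟨y, ((b.symm.mem_pull_compl _ _).1 y.2).1⟩,
            ((b.symm.mem_pull_compl _ _).1 y.2).2⟩,
          (a.mem_pull_compl _ _).2 ⟨(a.map.symm _).2, by
            rw [Subtype.coe_eta, RelIso.apply_symm_apply]
            exact (b.map.symm _).2⟩⟩
      left_inv := fun x => by
        have h := ((a.mem_pull_compl _ _).1 x.2).2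
        have e := RelIso.symm_apply_apply b.map ⟨_, h⟩
        have e1 : ∀ (z : ↥(b.source.interior)ᶜ) (_ : z = ⟨_, h⟩) (hz : (z : Vertex d) ∈ (a.target.interior)ᶜ),
            (a.map.symm ⟨z, hz⟩ : Vertex d) = x := by
          rintro z rfl hz
          rw [Subtype.coe_eta, RelIso.symm_apply_apply]
        exact Subtype.ext (e1 _ e _)
      right_inv := fun y => Subtype.ext (by
        simp only [Subtype.coe_eta, RelIso.apply_symm_apply])
      map_rel_iff' := by
        intro x y
        have h1 := a.map.map_rel_iff (a := ⟨x, ((a.mem_pull_compl _ _).1 x.2).1⟩)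
          (b := ⟨y, ((a.mem_pull_compl _ _).1 y.2).1⟩)
        have h2 := b.map.map_rel_iff (a := ⟨_, ((a.mem_pull_compl _ _).1 x.2).2⟩)
          (b := ⟨_, ((a.mem_pull_compl _ _).1 y.2).2⟩)
        exact h2.trans h1 }

theorem comp_apply (b a : ForestIso d) (v : Vertex d) (h : v ∈ ((b.comp a).source.interior)ᶜ)
    (ha : v ∈ (a.source.interior)ᶜ) (hb : (a.map ⟨v, ha⟩ : Vertex d) ∈ (b.source.interior)ᶜ) :
    ((b.comp a).map ⟨v, h⟩ : Vertex d) = b.map ⟨a.map ⟨v, ha⟩, hb⟩ := rfl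

/-- `a` and `b` agree outside the interior of `U`. -/
def AgreeOff (a b : ForestIso d) (U : AdmissibleSubtree d) : Prop :=
  ∀ (v : Vertex d) (ha : v ∈ (a.source.interior)ᶜ) (hb : v ∈ (b.source.interior)ᶜ),
    v ∈ (U.interior)ᶜ → (a.map ⟨v, ha⟩ : Vertex d) = b.map ⟨v, hb⟩

theorem equivalent_iff (a b : ForestIso d) : a.Equivalent b ↔ ∃ U, a.AgreeOff b U := by
  constructor
  · rintro ⟨c, h1, h2⟩
    exact ⟨c.source, fun v ha hb hc => (h1.2.2 v ha hc).trans (h2.2.2 v hb hc).symm⟩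
  · rintro ⟨U, hU⟩
    let W := U.union (a.source.union b.source)
    have hW : ∀ v, v ∈ (W.interior)ᶜ ↔ v ∈ (U.interior)ᶜ ∧ v ∈ (a.source.interior)ᶜ ∧
        v ∈ (b.source.interior)ᶜ := by
      intro v
      simp [W, interior_union]
    let c := a.comp (refl W)
    have hc : ∀ v, v ∈ (c.source.interior)ᶜ → v ∈ (U.interior)ᶜ ∧ v ∈ (a.source.interior)ᶜ ∧
        v ∈ (b.source.interior)ᶜ := fun v hv =>
      (hW v).1 (((refl W).mem_pull_compl _ _).1 hv).1
    have hca : ∀ (v : Vertex d) (h : v ∈ (c.source.interior)ᶜ),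
        (c.map ⟨v, h⟩ : Vertex d) = a.map ⟨v, (hc v h).2.1⟩ := fun v h => rfl
    have hcb : ∀ (v : Vertex d) (h : v ∈ (c.source.interior)ᶜ),
        (c.map ⟨v, h⟩ : Vertex d) = b.map ⟨v, (hc v h).2.2⟩ := fun v h =>
      (hca v h).trans (hU v _ _ (hc v h).1)
    refine ⟨c, ⟨?_, ?_, fun v ha hv => (hca v hv).symm⟩, ⟨?_, ?_, fun v hb hv => (hcb v hv).symm⟩⟩
    · exact le_of_interior_subset (Set.compl_subset_compl.1 fun v hv => (hc v hv).2.1)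
    · refine le_of_interior_subset (Set.compl_subset_compl.1 fun w hw => ?_)
      have := hca _ (c.map.symm ⟨w, hw⟩).2
      rw [Subtype.coe_eta, RelIso.apply_symm_apply] at this
      rw [show w = _ from this]
      exact Subtype.property _
    · exact le_of_interior_subset (Set.compl_subset_compl.1 fun v hv => (hc v hv).2.2)
    · refine le_of_interior_subset (Set.compl_subset_compl.1 fun w hw => ?_)
      have := hcb _ (c.map.symm ⟨w, hw⟩).2
      rw [Subtype.coe_eta, RelIso.apply_symm_apply] at this
      rw [show w = _ from this]
      exact Subtype.property _

theorem mem_union_compl (S T : AdmissibleSubtree d) (v : Vertex d) :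
    v ∈ ((S.union T).interior)ᶜ ↔ v ∈ (S.interior)ᶜ ∧ v ∈ (T.interior)ᶜ := by
  simp [interior_union]

theorem equivalent_refl (a : ForestIso d) : a.Equivalent a :=
  (equivalent_iff a a).2 ⟨a.source, fun _ _ _ _ => rfl⟩

theorem equivalent_symm {a b : ForestIso d} (h : a.Equivalent b) : b.Equivalent a :=
  let ⟨c, h1, h2⟩ := h
  ⟨c, h2, h1⟩

theorem equivalent_trans {a b c : ForestIso d} (h : a.Equivalent b) (h' : b.Equivalent c) :
    a.Equivalent c := by
  obtain ⟨U, hU⟩ := (equivalent_iff a b).1 h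
  obtain ⟨V, hV⟩ := (equivalent_iff b c).1 h'
  refine (equivalent_iff a c).2 ⟨b.source.union (U.union V), fun v ha hc hv => ?_⟩
  rw [mem_union_compl, mem_union_compl] at hv
  exact (hU v ha hv.1 hv.2.1).trans (hV v hv.1 hc hv.2.2)

instance setoid (d : ℕ) : Setoid (ForestIso d) :=
  ⟨Equivalent, equivalent_refl, equivalent_symm, equivalent_trans⟩

theorem comp_congr {b b' a a' : ForestIso d} (hb : b.Equivalent b') (ha : a.Equivalent a') :
    (b.comp a).Equivalent (b'.comp a') := by
  obtain ⟨U, hU⟩ := (equivalent_iff _ _).1 ha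
  obtain ⟨V, hV⟩ := (equivalent_iff _ _).1 hb
  refine (equivalent_iff _ _).2 ⟨U.union (a.pull V), fun v h h' hv => ?_⟩
  rw [mem_union_compl, mem_pull_compl] at hv
  obtain ⟨h1, h2⟩ := (a.mem_pull_compl _ _).1 h
  obtain ⟨h1', h2'⟩ := (a'.mem_pull_compl _ _).1 h'
  rw [comp_apply b a v h h1 h2, comp_apply b' a' v h' h1' h2']
  have e := hU v h1 h1' hv.1
  have h3 : (a.map ⟨v, h1⟩ : Vertex d) ∈ (b'.source.interior)ᶜ := e ▸ h2'
  rw [hV _ h2 h3 hv.2.2]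
  simp only [e]

theorem symm_congr {a a' : ForestIso d} (ha : a.Equivalent a') :
    a.symm.Equivalent a'.symm := by
  obtain ⟨U, hU⟩ := (equivalent_iff _ _).1 ha
  refine (equivalent_iff _ _).2 ⟨a.symm.pull (U.union a'.source), fun w h h' hw => ?_⟩
  obtain ⟨h1, h2⟩ := (mem_pull_compl _ _ _).1 hw
  rw [mem_union_compl] at h2
  have e := hU _ (a.symm.map ⟨w, h1⟩).2 h2.2 h2.1
  have e1 : a.map ⟨a.symm.map ⟨w, h1⟩, (a.symm.map ⟨w, h1⟩).2⟩ = ⟨w, h1⟩ :=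
    RelIso.apply_symm_apply a.map _
  rw [e1] at e
  have e2 : a'.map ⟨a.symm.map ⟨w, h1⟩, h2.2⟩ = ⟨w, h'⟩ := Subtype.ext e.symm
  have e3 : (⟨a.symm.map ⟨w, h1⟩, h2.2⟩ : ↥(a'.source.interior)ᶜ) = a'.map.symm ⟨w, h'⟩ := by
    rw [← e2, RelIso.symm_apply_apply]
  exact congrArg Subtype.val e3

end ForestIso

/-- The group of almost automorphisms of the rooted `d`-regular tree (for `d ≥ 2`, this is the
`d`-th Neretin group): triples `(ψ, S, S')` up to equivalence. -/
def AAut (d : ℕ) : Type := Quotient (ForestIso.setoid d)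

namespace AAut

variable {d : ℕ}

/-- The almost automorphism represented by a triple. -/
def mk (a : ForestIso d) : AAut d := Quotient.mk _ a

/-- Two triples represent the same almost automorphism exactly when they are equivalent. -/
theorem mk_eq_mk {a b : ForestIso d} : mk a = mk b ↔ a.Equivalent b :=
  ⟨fun h => Quotient.exact h, fun h => Quotient.sound h⟩

/-- The group law is composition: `mk b * mk a` is represented by `b ∘ a`. -/
noncomputable instance : Group (AAut d) where
  mul := Quotient.map₂ ForestIso.comp fun _ _ hb _ _ ha => ForestIso.comp_congr hb ha
  one := mk (ForestIso.refl (AdmissibleSubtree.root d))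
  inv := Quotient.map ForestIso.symm fun _ _ h => ForestIso.symm_congr h
  mul_assoc := by
    rintro ⟨c⟩ ⟨b⟩ ⟨a⟩
    exact Quotient.sound ((ForestIso.equivalent_iff _ _).2 ⟨a.source, fun _ _ _ _ => rfl⟩)
  one_mul := by
    rintro ⟨a⟩
    exact Quotient.sound ((ForestIso.equivalent_iff _ _).2 ⟨a.source, fun _ _ _ _ => rfl⟩)
  mul_one := by
    rintro ⟨a⟩
    exact Quotient.sound ((ForestIso.equivalent_iff _ _).2 ⟨a.source, fun _ _ _ _ => rfl⟩)
  inv_mul_cancel := by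
    rintro ⟨a⟩
    exact Quotient.sound ((ForestIso.equivalent_iff _ _).2 ⟨a.source, fun v _ _ h =>
      congrArg Subtype.val (RelIso.symm_apply_apply a.map ⟨v, h⟩)⟩)

theorem mk_mul_mk (b a : ForestIso d) : mk b * mk a = mk (b.comp a) := rfl

/-- The homomorphism sending an automorphism `ψ` of the forest complementary to `S` to the almost
automorphism represented by `(ψ, S, S)`. -/
noncomputable def ofForestAut (S : AdmissibleSubtree d) : (S.forest ≃g S.forest) →* AAut d where
  toFun ψ := mk ⟨S, S, ψ⟩
  map_one' := mk_eq_mk.2 ((ForestIso.equivalent_iff _ _).2 ⟨S, fun _ _ _ _ => rfl⟩)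
  map_mul' _ _ := mk_eq_mk.2 ((ForestIso.equivalent_iff _ _).2 ⟨S, fun _ _ _ _ => rfl⟩)

/-- The automorphism group of the cofinite subforest complementary to `S`, as a subgroup of the
group of almost automorphisms. -/
noncomputable def forestAut (S : AdmissibleSubtree d) : Subgroup (AAut d) := (ofForestAut S).range

end AAut

end Neretin

/-!
An element `g` of the Neretin group may carry the full subtree below a vertex `v` onto the full
subtree below a vertex `w`; this is the relation `CarriesBall g v w`, which is compatible with
products and inverses.

An element of `forestAut S` never carries the ball of a vertex `u` onto the ball of a proper
descendant of `u` (`eq_nil_of_carriesBall`): iterating, it would do so for arbitrarily deep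
vertices, hence for a vertex `y` so deep that it acts there as an automorphism `ψ` of the forest
complementary to `S`. Then `ψ⁻¹ y` is a proper ancestor of `y` with the same property, and so
on up the tree, which is absurd.

Now represent finitely many generators and their inverses by triples whose sources all lie in one
admissible subtree `S`. Call a vertex *exposed* if some chain of these triples, applied as partial
maps on vertices, moves it into the interior of `S`. Ancestors of exposed vertices are exposed. If
two of the ancestors of an exposed vertex `v` are moved to the same interior vertex of `S`, the
subgroup contains an element carrying the ball of one onto the ball of the other, so by
ellipticity they are equal. Hence `v` and its proper ancestors together number at most as many as
the interior vertices of `S`, so there are finitely many exposed vertices. They form the interior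
of an admissible subtree, and every generator permutes the vertices outside of it.
-/

namespace Neretin

open AdmissibleSubtree

variable {d : ℕ}

/-! ### Complements of interiors and relative depth -/

namespace AdmissibleSubtree

theorem append_mem_compl_interior (S : AdmissibleSubtree d) (p : Vertex d) {v : Vertex d}
    (hv : v ∈ (S.interior)ᶜ) : p ++ v ∈ (S.interior)ᶜ := by
  induction p with
  | nil => exact hv
  | cons i p ih => exact fun h => ih (S.interior_parent h)

theorem mem_compl_interior_of_le {S T : AdmissibleSubtree d} (h : S ≤ T) {v : Vertex d}
    (hv : v ∈ (T.interior)ᶜ) : v ∈ (S.interior)ᶜ :=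
  fun h' => hv (interior_mono h h')

theorem exists_length_mem_compl_interior (S : AdmissibleSubtree d) :
    ∃ n, ∀ v : Vertex d, n ≤ v.length → v ∈ (S.interior)ᶜ := by
  obtain ⟨n, hn⟩ := (S.interior_finite.image List.length).bddAbove
  refine ⟨n + 1, fun v hv h => ?_⟩
  have := hn ⟨v, h, rfl⟩
  omega

theorem exists_forall_le {ι : Type*} (f : ι → AdmissibleSubtree d) {F : Set ι} (hF : F.Finite) :
    ∃ S, ∀ i ∈ F, f i ≤ S := by
  induction F, hF using Set.Finite.induction_on with
  | empty => exact ⟨root d, by simp⟩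
  | @insert a F _ _ ih =>
    obtain ⟨S, hS⟩ := ih
    refine ⟨(f a).union S, fun i hi => ?_⟩
    rcases hi with rfl | hi
    · exact fun v hv => Finset.mem_union_left _ hv
    · exact fun v hv => Finset.mem_union_right _ (hS i hi hv)

end AdmissibleSubtree

/-- A forest isomorphism preserves relative depth. -/
theorem ForestIso.map_append {S T : AdmissibleSubtree d} (φ : S.forest ≃g T.forest)
    (p v : Vertex d) (hv : v ∈ (S.interior)ᶜ) (hpv : p ++ v ∈ (S.interior)ᶜ) :
    ∃ q : Vertex d, q.length = p.length ∧
      (φ ⟨p ++ v, hpv⟩ : Vertex d) = q ++ (φ ⟨v, hv⟩ : Vertex d) := by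
  induction p with
  | nil => exact ⟨[], rfl, rfl⟩
  | cons i p ih =>
    have hpv' := S.append_mem_compl_interior p hv
    obtain ⟨q, hq, e⟩ := ih hpv'
    obtain ⟨j, hj⟩ := map_child φ (p ++ v) i hpv' hpv
    exact ⟨j :: q, by simp [hq], hj.trans (by rw [e, List.cons_append])⟩

namespace AAut

/-! ### Action on balls -/

/-- `g` carries the ball of `v` (the set of ends of the tree below `v`) onto the ball of `w` by a
tree isomorphism: some triple representing `g` is defined at `v` and sends it to `w`. -/
def CarriesBall (g : AAut d) (v w : Vertex d) : Prop :=
  ∃ (a : ForestIso d) (hv : v ∈ (a.source.interior)ᶜ), mk a = g ∧ (a.map ⟨v, hv⟩ : Vertex d) = w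

theorem carriesBall_one (v : Vertex d) : CarriesBall 1 v v :=
  ⟨ForestIso.refl (root d), fun ⟨i, hi⟩ => List.cons_ne_nil i v (Finset.mem_singleton.1 hi),
    rfl, rfl⟩

theorem CarriesBall.mul {g h : AAut d} {u v w : Vertex d} (hh : CarriesBall h v w)
    (hg : CarriesBall g u v) : CarriesBall (h * g) u w := by
  obtain ⟨a, hu, rfl, rfl⟩ := hg
  obtain ⟨b, hv, rfl, rfl⟩ := hh
  exact ⟨b.comp a, (a.mem_pull_compl _ _).2 ⟨hu, hv⟩, rfl, rfl⟩

theorem CarriesBall.inv {g : AAut d} {v w : Vertex d} (h : CarriesBall g v w) :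
    CarriesBall g⁻¹ w v := by
  obtain ⟨a, hv, rfl, rfl⟩ := h
  exact ⟨a.symm, (a.map _).2, rfl, congrArg Subtype.val (RelIso.symm_apply_apply a.map ⟨v, hv⟩)⟩

/-! ### Elliptic elements do not contract balls -/

/-- An automorphism of a forest moves no vertex to a proper descendant: otherwise the preimage of
that vertex would be a proper ancestor with the same property. -/
theorem eq_nil_of_forestAut_apply {S : AdmissibleSubtree d} (ψ : S.forest ≃g S.forest)
    (y q : Vertex d) (hy : y ∈ (S.interior)ᶜ) (h : (ψ ⟨y, hy⟩ : Vertex d) = q ++ y) : q = [] := by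
  induction hn : y.length using Nat.strong_induction_on generalizing y q with
  | _ n ih =>
    by_contra hq
    have hqy := S.append_mem_compl_interior q hy
    obtain ⟨p, hp, e⟩ := ForestIso.map_append ψ.symm q y hy hqy
    have e1 : ψ.symm ⟨q ++ y, hqy⟩ = ⟨y, hy⟩ := by
      rw [RelIso.symm_apply_eq]
      exact Subtype.ext h.symm
    rw [e1] at e
    change y = p ++ (ψ.symm ⟨y, hy⟩ : Vertex d) at e
    have hp0 : 0 < p.length := hp ▸ List.length_pos_iff.2 hq
    have hlen := congrArg List.length e
    rw [List.length_append] at hlen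
    have := ih _ (by omega) (ψ.symm ⟨y, hy⟩ : Vertex d) p (ψ.symm ⟨y, hy⟩).2
      (by rw [Subtype.coe_eta, RelIso.apply_symm_apply]; exact e) rfl
    simp [this] at hp0

/-- If `a` moves some vertex to a proper descendant, then iterating shows that it does so for
arbitrarily deep vertices. -/
theorem exists_deep_descendant (a : ForestIso d) {u q : Vertex d} (hu : u ∈ (a.source.interior)ᶜ)
    (hq : q ≠ []) (h : (a.map ⟨u, hu⟩ : Vertex d) = q ++ u) (n : ℕ) :
    ∃ (y p : Vertex d) (hy : y ∈ (a.source.interior)ᶜ), n ≤ y.length ∧ p ≠ [] ∧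
      (a.map ⟨y, hy⟩ : Vertex d) = p ++ y := by
  induction n with
  | zero => exact ⟨u, q, hu, Nat.zero_le _, hq, h⟩
  | succ n ih =>
    obtain ⟨y, p, hy, hn, hp, e⟩ := ih
    have hpy := a.source.append_mem_compl_interior p hy
    obtain ⟨p', hp', e'⟩ := ForestIso.map_append a.map p y hy hpy
    have h0 := List.length_pos_iff.2 hp
    refine ⟨p ++ y, p', hpy, ?_, ?_, e'.trans (by rw [e])⟩
    · rw [List.length_append]
      omega
    · exact List.length_pos_iff.1 (hp' ▸ h0)

theorem eq_nil_of_carriesBall {g : AAut d} {S : AdmissibleSubtree d} (hg : g ∈ forestAut S)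
    {u q : Vertex d} (h : CarriesBall g u (q ++ u)) : q = [] := by
  obtain ⟨ψ, hψ⟩ := hg
  obtain ⟨a, hu, ha, e⟩ := h
  obtain ⟨U, hU⟩ := (ForestIso.equivalent_iff _ _).1 (mk_eq_mk.1 (ha.trans hψ.symm))
  by_contra hq
  obtain ⟨n, hn⟩ := U.exists_length_mem_compl_interior
  obtain ⟨m, hm⟩ := S.exists_length_mem_compl_interior
  obtain ⟨y, p, hy, hlen, hp, ey⟩ := exists_deep_descendant a hu hq e (max n m)
  have hyS := hm y ((le_max_right _ _).trans hlen)
  exact hp (eq_nil_of_forestAut_apply ψ y p hyS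
    ((hU y hy hyS (hn y ((le_max_left _ _).trans hlen))).symm.trans ey))

/-! ### Exposed vertices -/

/-- The vertices which some chain of triples in `F`, applied as partial maps on vertices, moves
into the interior of `S`. -/
inductive Exposed (F : Set (ForestIso d)) (S : AdmissibleSubtree d) : Vertex d → Prop
  | interior {v : Vertex d} : v ∈ S.interior → Exposed F S v
  | step {v : Vertex d} (a : ForestIso d) (ha : a ∈ F) (hv : v ∈ (a.source.interior)ᶜ) :
      Exposed F S (a.map ⟨v, hv⟩ : Vertex d) → Exposed F S v

variable {F : Set (ForestIso d)} {S : AdmissibleSubtree d}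

theorem Exposed.parent (hS : ∀ a ∈ F, a.source ≤ S) {i : Fin d} {v : Vertex d}
    (h : Exposed F S (i :: v)) : Exposed F S v := by
  generalize hw : i :: v = w at h
  induction h generalizing i v with
  | interior h => exact .interior (S.interior_parent (hw ▸ h))
  | step a ha hiv _ ih =>
    subst hw
    by_cases hv : v ∈ a.source.interior
    · exact .interior (interior_mono (hS a ha) hv)
    · obtain ⟨j, hj⟩ := ForestIso.map_child a.map v i hv hiv
      exact .step a ha hv (ih hj.symm)

theorem Exposed.drop (hS : ∀ a ∈ F, a.source ≤ S) {v : Vertex d} (h : Exposed F S v) (k : ℕ) :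
    Exposed F S (v.drop k) := by
  induction k generalizing v with
  | zero => exact h
  | succ k ih =>
    cases v with
    | nil => exact h
    | cons i v => exact ih (h.parent hS)

theorem Exposed.exists_carriesBall {H : Subgroup (AAut d)} (hF : ∀ a ∈ F, mk a ∈ H) {v : Vertex d}
    (h : Exposed F S v) : ∃ g ∈ H, ∃ s ∈ S.interior, CarriesBall g v s := by
  induction h with
  | interior h => exact ⟨1, H.one_mem, _, h, carriesBall_one _⟩
  | step a ha hv _ ih =>
    obtain ⟨g, hg, s, hs, hgs⟩ := ih
    exact ⟨g * mk a, H.mul_mem hg (hF a ha), s, hs, hgs.mul ⟨a, hv, rfl, rfl⟩⟩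

/-- Distinct ancestors of an exposed vertex are carried to distinct interior vertices of `S`,
because no element of `H` carries the ball of a vertex onto the ball of a proper descendant. -/
theorem Exposed.length_lt {H : Subgroup (AAut d)} (hF : ∀ a ∈ F, mk a ∈ H)
    (hS : ∀ a ∈ F, a.source ≤ S) (hell : ∀ g ∈ H, ∃ T, g ∈ forestAut T) {v : Vertex d}
    (h : Exposed F S v) : v.length < S.interior.ncard := by
  choose g hg s hs hgs using fun k => (h.drop hS k).exists_carriesBall hF
  have hne : ∀ k l, k < l → l ≤ v.length → s k ≠ s l := by
    intro k l hkl hl hsk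
    -- The ball of the shallower ancestor `v.drop l` is carried onto that of `v.drop k`.
    have hc := (hgs k).inv.mul (hsk ▸ hgs l)
    obtain ⟨T, hT⟩ := hell _ (H.mul_mem (H.inv_mem (hg k)) (hg l))
    have hd : v.drop k = (v.drop k).take (l - k) ++ v.drop l := by
      conv_lhs => rw [← List.take_append_drop (l - k) (v.drop k)]
      rw [List.drop_drop, Nat.add_sub_cancel' hkl.le]
    rw [hd] at hc
    have := congrArg List.length (eq_nil_of_carriesBall hT hc)
    simp only [List.length_take, List.length_drop, List.length_nil] at this
    omega
  have hcard := Set.ncard_le_ncard_of_injOn (s := ↑(Finset.range (v.length + 1))) s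
    (fun k _ => hs k) (fun k hk l hl hkl => by
      simp only [Finset.coe_range, Set.mem_Iio] at hk hl
      rcases lt_trichotomy k l with hlt | heq | hlt
      · exact absurd hkl (hne k l hlt (by omega))
      · exact heq
      · exact absurd hkl.symm (hne l k hlt (by omega))) S.interior_finite
  rw [Set.ncard_coe_finset, Finset.card_range] at hcard
  omega

theorem finite_setOf_exposed {H : Subgroup (AAut d)} (hF : ∀ a ∈ F, mk a ∈ H)
    (hS : ∀ a ∈ F, a.source ≤ S) (hell : ∀ g ∈ H, ∃ T, g ∈ forestAut T) :
    {v | Exposed F S v}.Finite :=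
  (List.finite_length_lt (Fin d) S.interior.ncard).subset fun _ h => h.length_lt hF hS hell

/-! ### The invariant subforest -/

/-- A triple `a` which, together with its inverse, maps the forest complementary to `T` into itself
represents an element of `forestAut T`. -/
theorem mk_mem_forestAut {T : AdmissibleSubtree d} (a : ForestIso d)
    (hs : ∀ v ∈ (T.interior)ᶜ, ∃ h : v ∈ (a.source.interior)ᶜ,
      (a.map ⟨v, h⟩ : Vertex d) ∈ (T.interior)ᶜ)
    (ht : ∀ v ∈ (T.interior)ᶜ, ∃ h : v ∈ (a.target.interior)ᶜ,
      (a.map.symm ⟨v, h⟩ : Vertex d) ∈ (T.interior)ᶜ) : mk a ∈ forestAut T := by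
  let ψ : T.forest ≃g T.forest :=
    { toFun := fun x => ⟨a.map ⟨x, (hs x x.2).1⟩, (hs x x.2).2⟩
      invFun := fun y => ⟨a.map.symm ⟨y, (ht y y.2).1⟩, (ht y y.2).2⟩
      left_inv := fun x => Subtype.ext (by
        simp only [Subtype.coe_eta, RelIso.symm_apply_apply])
      right_inv := fun y => Subtype.ext (by
        simp only [Subtype.coe_eta, RelIso.apply_symm_apply])
      map_rel_iff' := fun {x y} =>
        a.map.map_rel_iff (a := ⟨x, (hs x x.2).1⟩) (b := ⟨y, (hs y y.2).1⟩) }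
  exact ⟨ψ, mk_eq_mk.2 ((ForestIso.equivalent_iff _ _).2 ⟨T, fun _ _ _ _ => rfl⟩)⟩

end AAut

end Neretin

open Neretin Neretin.AdmissibleSubtree Neretin.AAut in
theorem theorem1p2 (d : ℕ) (hd : 2 ≤ d) (H : Subgroup (Neretin.AAut d)) (hfg : H.FG)
    (hell : ∀ g ∈ H, ∃ S : Neretin.AdmissibleSubtree d, g ∈ Neretin.AAut.forestAut S) :
    ∃ S : Neretin.AdmissibleSubtree d, H ≤ Neretin.AAut.forestAut S := by
  obtain ⟨G, rfl⟩ := hfg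
  choose rep hrep using fun g : AAut d => Quotient.exists_rep g
  -- A finite set of triples representing the generators, closed under inverses.
  let F : Set (ForestIso d) := rep '' G ∪ ForestIso.symm '' (rep '' G)
  have hfin : F.Finite := (G.finite_toSet.image _).union ((G.finite_toSet.image _).image _)
  have hsymm : ∀ a ∈ F, a.symm ∈ F := by
    rintro a (ha | ⟨b, hb, rfl⟩)
    · exact Or.inr ⟨a, ha, rfl⟩
    · exact Or.inl hb
  have hF : ∀ a ∈ F, mk a ∈ Subgroup.closure (G : Set (AAut d)) := by
    have h : ∀ a ∈ rep '' G, mk a ∈ Subgroup.closure (G : Set (AAut d)) := by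
      rintro _ ⟨g, hg, rfl⟩
      exact Subgroup.subset_closure (by rwa [show mk (rep g) = g from hrep g])
    rintro a (ha | ⟨b, hb, rfl⟩)
    · exact h a ha
    · exact inv_mem (h b hb)
  obtain ⟨S, hS⟩ := exists_forall_le ForestIso.source hfin
  let T := ofInterior {v | Exposed F S v} (finite_setOf_exposed hF hS hell)
    fun _ _ h => Exposed.parent hS h
  have hT : T.interior = {v | Exposed F S v} :=
    interior_ofInterior _ _ _ fun _ _ => ⟨⟨0, by omega⟩⟩
  have hstable : ∀ a ∈ F, ∀ v ∈ (T.interior)ᶜ, ∃ h : v ∈ (a.source.interior)ᶜ,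
      (a.map ⟨v, h⟩ : Vertex d) ∈ (T.interior)ᶜ := by
    intro a ha v hv
    rw [hT] at hv ⊢
    have hvS : v ∈ (S.interior)ᶜ := fun h => hv (Exposed.interior h)
    exact ⟨mem_compl_interior_of_le (hS a ha) hvS, fun h => hv (Exposed.step a ha _ h)⟩
  refine ⟨T, (Subgroup.closure_le _).2 fun g hg => ?_⟩
  have hgF : rep g ∈ F := Or.inl ⟨g, hg, rfl⟩
  rw [← hrep g]
  exact mk_mem_forestAut (rep g) (hstable _ hgF) (hstable _ (hsymm _ hgF))
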